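/- Let $V:\mathbb R\to\mathbb R$ satisfy $$V\in C(\mathbb R)\cap L^1(\mathbb R),\qquad \lim_{|x|\to\infty}V(x)=0,\qquad \int_{\mathbb R}V(x)\,dx<0,$$ and let $\mathcal A=-\partial_x^2+V$ be the unbounded operator on the complex Hilbert space $L^2(\mathbb R)$ with domain $D(\mathcal A)=H^2(\mathbb R)$. Then there are an index set $\mathcal N$, either $\mathcal N=\{0,\dots,N\}$ for some integer $N\ge 0$ or $\mathcal N=\mathbb N$, and real numbers $(\lambda_n)_{n\in\mathcal N}$ with $\lambda_0>\lambda_1>\dots>\lambda_n>\dots>0$ such that each $-\lambda_n^2$ is an eigenvalue of $\mathcal A$, $$\sigma(\mathcal A)=\{-\lambda_n^2\}_{n\in\mathcal N}\cup[0,\infty),$$ and the set $\{-\lambda_n^2\}_{n\in\mathcal N}$ has no accumulation point other than possibly $0$. Here $\sigma(\mathcal A)\subset\mathbb C$ is the complement of the set of $z\in\mathbb C$ for which $\mathcal A-z:H^2(\mathbb R)\to L^2(\mathbb R)$ is bijective with bounded inverse on $L^2(\mathbb R)$. -/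

import Mathlib

open MeasureTheory Filter Topology TemperedDistribution
open scoped ENNReal SchwartzMap LineDeriv

noncomputable section

namespace Schroedinger

/-- The Hilbert space `L²(ℝ) = L²(ℝ; ℂ)` with respect to Lebesgue measure. -/
abbrev L2 : Type := Lp ℂ 2 (volume : Measure ℝ)

/-- The condition `V ∈ C(ℝ) ∩ L¹(ℝ)`, `V(x) → 0` as `|x| → ∞`, `∫ V dx < 0`
on a real-valued potential `V`. -/
structure IsAdmissiblePotential (V : ℝ → ℝ) : Prop where
  continuous : Continuous V
  integrable : Integrable V volume
  tendsto_zero : Tendsto V (cocompact ℝ) (𝓝 0)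
  integral_neg : ∫ x, V x < 0

/-- The Sobolev space `H²(ℝ)`, as a subspace of `L²(ℝ)`. -/
def sobolevH2 : Submodule ℂ L2 where
  carrier := {u | MemSobolev 2 2 (u : 𝓢'(ℝ, ℂ))}
  zero_mem' := by
    have h : ((0 : L2) : 𝓢'(ℝ, ℂ)) = 0 :=
      map_zero (Lp.toTemperedDistributionCLM ℂ (volume : Measure ℝ) 2)
    simp [h]
  add_mem' {u v} hu hv := by
    have h : ((u + v : L2) : 𝓢'(ℝ, ℂ)) = u + v :=
      map_add (Lp.toTemperedDistributionCLM ℂ (volume : Measure ℝ) 2) u v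
    simpa [h] using MemSobolev.add hu hv
  smul_mem' c u hu := by
    have h : ((c • u : L2) : 𝓢'(ℝ, ℂ)) = c • (u : 𝓢'(ℝ, ℂ)) :=
      map_smul (Lp.toTemperedDistributionCLM ℂ (volume : Measure ℝ) 2) c u
    simpa [h] using MemSobolev.smul c hu

/-- An `L²` function is determined by the tempered distribution it defines. -/
theorem toTemperedDistribution_injective {f g : L2}
    (h : (f : 𝓢'(ℝ, ℂ)) = (g : 𝓢'(ℝ, ℂ))) : f = g := by
  have hk := Lp.ker_toTemperedDistributionCLM_eq_bot (F := ℂ) (μ := (volume : Measure ℝ)) (p := 2)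
  exact LinearMap.ker_eq_bot.mp hk h

/-- The second distributional derivative of an `H²` function is an `L²` function. -/
theorem exists_secondDeriv (u : sobolevH2) :
    ∃ f : L2, ∂_{(1 : ℝ)} (∂_{(1 : ℝ)} ((u : L2) : 𝓢'(ℝ, ℂ))) = (f : 𝓢'(ℝ, ℂ)) := by
  have h : MemSobolev (2 - 1 - 1) 2 (∂_{(1 : ℝ)} (∂_{(1 : ℝ)} ((u : L2) : 𝓢'(ℝ, ℂ)))) :=
    MemSobolev.lineDerivOp (MemSobolev.lineDerivOp u.2)
  rw [show (2 - 1 - 1 : ℝ) = 0 by norm_num] at h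
  exact memSobolev_zero_iff.mp h

/-- The second derivative `∂ₓ² : H²(ℝ) → L²(ℝ)`, in the sense of distributions. -/
def secondDeriv : sobolevH2 →ₗ[ℂ] L2 where
  toFun u := (exists_secondDeriv u).choose
  map_add' u v := by
    apply toTemperedDistribution_injective
    have h (f g : L2) : ((f + g : L2) : 𝓢'(ℝ, ℂ)) = f + g :=
      map_add (Lp.toTemperedDistributionCLM ℂ (volume : Measure ℝ) 2) f g
    rw [h, ← (exists_secondDeriv u).choose_spec, ← (exists_secondDeriv v).choose_spec,
      ← (exists_secondDeriv (u + v)).choose_spec, Submodule.coe_add, h,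
      LineDeriv.lineDerivOp_add, LineDeriv.lineDerivOp_add]
  map_smul' c u := by
    apply toTemperedDistribution_injective
    have h (f : L2) : ((c • f : L2) : 𝓢'(ℝ, ℂ)) = c • (f : 𝓢'(ℝ, ℂ)) :=
      map_smul (Lp.toTemperedDistributionCLM ℂ (volume : Measure ℝ) 2) c f
    rw [RingHom.id_apply, h, ← (exists_secondDeriv u).choose_spec,
      ← (exists_secondDeriv (c • u)).choose_spec, Submodule.coe_smul, h,
      LineDeriv.lineDerivOp_smul, LineDeriv.lineDerivOp_smul]

/-- Defining property of `secondDeriv`. -/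
theorem secondDeriv_spec (u : sobolevH2) :
    (secondDeriv u : 𝓢'(ℝ, ℂ)) = ∂_{(1 : ℝ)} (∂_{(1 : ℝ)} ((u : L2) : 𝓢'(ℝ, ℂ))) :=
  (exists_secondDeriv u).choose_spec.symm

/-- An admissible potential is bounded. -/
theorem IsAdmissiblePotential.memLp_top {V : ℝ → ℝ} (hV : IsAdmissiblePotential V) :
    MemLp (fun x ↦ (V x : ℂ)) ∞ (volume : Measure ℝ) := by
  let W : ZeroAtInftyContinuousMap ℝ ℝ := ⟨⟨V, hV.continuous⟩, hV.tendsto_zero⟩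
  refine memLp_top_of_bound
    (Complex.continuous_ofReal.comp hV.continuous).aestronglyMeasurable ‖W.toBCF‖
    (Eventually.of_forall fun x ↦ ?_)
  rw [Complex.norm_real]
  exact W.toBCF.norm_coe_le_norm x

/-- Multiplication by an admissible potential preserves `L²`. -/
theorem IsAdmissiblePotential.memLp_mul {V : ℝ → ℝ} (hV : IsAdmissiblePotential V) (u : L2) :
    MemLp (fun x ↦ (V x : ℂ) * u x) 2 (volume : Measure ℝ) :=
  (Lp.memLp u).mul hV.memLp_top

/-- The multiplication operator `u ↦ V u` on `L²(ℝ)`. -/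
def mulPotential {V : ℝ → ℝ} (hV : IsAdmissiblePotential V) : L2 →ₗ[ℂ] L2 where
  toFun u := (hV.memLp_mul u).toLp _
  map_add' u v := by
    rw [← MemLp.toLp_add]
    refine MemLp.toLp_congr _ _ ?_
    filter_upwards [Lp.coeFn_add u v] with x hx
    change (V x : ℂ) * (u + v : L2) x = (V x : ℂ) * u x + (V x : ℂ) * v x
    rw [hx, Pi.add_apply, mul_add]
  map_smul' c u := by
    rw [RingHom.id_apply, ← MemLp.toLp_const_smul]
    refine MemLp.toLp_congr _ _ ?_
    filter_upwards [Lp.coeFn_smul c u] with x hx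
    simp [hx, mul_left_comm]

/-- The Schrödinger operator `𝒜 = -∂ₓ² + V` in `L²(ℝ)` with domain `D(𝒜) = H²(ℝ)`. -/
def operatorA {V : ℝ → ℝ} (hV : IsAdmissiblePotential V) : L2 →ₗ.[ℂ] L2 where
  domain := sobolevH2
  toFun := -secondDeriv + (mulPotential hV).comp sobolevH2.subtype

section Spectrum

variable {E : Type*} [NormedAddCommGroup E] [NormedSpace ℂ E]

/-- The resolvent set of a linear operator `T` with domain `T.domain ⊆ E`: all `z` such that
`T - z : T.domain → E` is bijective with bounded inverse `R : E → E`. -/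
def resolventSet (T : E →ₗ.[ℂ] E) : Set ℂ :=
  {z | ∃ R : E →L[ℂ] E,
    (∀ f : E, ∃ h : R f ∈ T.domain, T ⟨R f, h⟩ - z • R f = f) ∧
    (∀ u : T.domain, R (T u - z • (u : E)) = u)}

/-- The spectrum of a (possibly unbounded) linear operator. -/
def spectrum (T : E →ₗ.[ℂ] E) : Set ℂ := (resolventSet T)ᶜ

/-- `z` is an eigenvalue of `T`. -/
def IsEigenvalue (T : E →ₗ.[ℂ] E) (z : ℂ) : Prop :=
  ∃ u : T.domain, u ≠ 0 ∧ T u = z • (u : E)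

end Spectrum

end Schroedinger

end

/-!
On the Fourier side `-∂ₓ²` is multiplication by the symbol `(2πξ)²`, and `H²(ℝ)` consists of the
`u` for which `(2πξ)² û` is square integrable. Hence for `z ∉ [0, ∞)` the free resolvent
`R₀(z) = (-∂ₓ² - z)⁻¹` is the Fourier multiplier with symbol `((2πξ)² - z)⁻¹`.

Everything about the essential spectrum rests on the compactness of `V R₀(z)`
(`isCompactOperator_potentialL_freeResolvent`). Composed with `𝓕⁻¹` it is an integral operator
with kernel `V(x) m(ξ) e^{2πixξ}`, where `m` is the symbol of `R₀(z)`; since `V ∈ L¹ ∩ L^∞ ⊆ L²` and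
`m ∈ L²`, this is a Hilbert–Schmidt operator. There are three consequences.

* Since `𝒜 - z = (1 + V R₀(z)) (-∂ₓ² - z)`, the Fredholm alternative shows that every
  `z ∉ [0, ∞)` is in the resolvent set or an eigenvalue (`mem_resolventSet_or_isEigenvalue`); by
  symmetry of `𝒜`, eigenvalues are real.
* Along orthonormal sequences with bounded graph norm `V u_n → 0`
  (`tendsto_potentialL_orthonormal`). Applied to wave packets with frequencies shrinking to `k`,
  this makes a Weyl sequence for `-∂ₓ²` at `(2πk)²` one for `𝒜`, so that `[0, ∞) ⊆ σ(𝒜)`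
  (`ofReal_mem_spectrum`).
* Applied to normalised eigenfunctions, the same fact shows that there are only finitely many
  eigenvalues below `-ε`, for every `ε > 0` (`finite_isEigenvalue_le`), because
  `-∂ₓ² + |t| ≥ |t|`.

That a negative eigenvalue exists (`exists_neg_isEigenvalue`) is a matter of energy: the functions
with Fourier transform `ε⁻¹ 1_(0, ε]` have total energy tending to `∫ V < 0`, while in the absence
of negative spectrum the functional calculus for `(𝒜 + 1)⁻¹` would give `⟪𝒜 u, u⟫ ≥ 0`. Finally,
a set of positive numbers which is finite away from `0` can be listed in decreasing order
(`exists_strictAntiOn_enumeration`).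
-/

namespace Schroedinger

open FourierTransform

/-! ### Compact operators and orthonormal sequences -/

theorem tendsto_inner_orthonormal {H : Type*} [NormedAddCommGroup H] [InnerProductSpace ℂ H]
    {e : ℕ → H} (he : Orthonormal ℂ e) (y : H) :
    Tendsto (fun n ↦ inner ℂ (e n) y) atTop (𝓝 0) := by
  have h := (he.inner_products_summable y).tendsto_atTop_zero
  have h2 : Tendsto (fun n ↦ ‖inner ℂ (e n) y‖) atTop (𝓝 0) := by
    have := h.sqrt
    simpa [Real.sqrt_sq (norm_nonneg _)] using this
  exact tendsto_zero_iff_norm_tendsto_zero.mpr h2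

/-- A compact operator turns the weak convergence to `0` of an orthonormal sequence into norm
convergence. -/
theorem tendsto_compact_orthonormal {H : Type*} [NormedAddCommGroup H] [InnerProductSpace ℂ H]
    [CompleteSpace H] {K : H →L[ℂ] H} (hK : IsCompactOperator K)
    {e : ℕ → H} (he : Orthonormal ℂ e) :
    Tendsto (fun n ↦ K (e n)) atTop (𝓝 0) := by
  refine tendsto_of_subseq_tendsto fun ns hns ↦ ?_
  obtain ⟨C, hC, hKC⟩ := hK.image_closedBall_subset_compact 1
  obtain ⟨y, -, φ, hφ, hy⟩ := hC.tendsto_subseq (x := fun n ↦ K (e (ns n)))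
    (fun n ↦ hKC ⟨e (ns n), by simp [he.1], rfl⟩)
  refine ⟨φ, ?_⟩
  -- the limit `y` is orthogonal to itself, since `⟪K (e n), y⟫ = ⟪e n, K† y⟫ → 0`
  have h1 : Tendsto (fun n ↦ inner ℂ (K (e (ns (φ n)))) y) atTop (𝓝 (inner ℂ y y)) :=
    hy.inner tendsto_const_nhds
  have h2 : Tendsto (fun n ↦ inner ℂ (K (e (ns (φ n)))) y) atTop (𝓝 0) := by
    simp_rw [← ContinuousLinearMap.adjoint_inner_right]
    exact (tendsto_inner_orthonormal he _).comp (hns.comp hφ.tendsto_atTop)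
  have h3 : y = 0 := inner_self_eq_zero.mp (tendsto_nhds_unique h1 h2)
  rw [← h3]
  exact hy

/-! ### Hilbert–Schmidt operators -/

section HilbertSchmidt

variable {α E : Type*} [MeasurableSpace α] {μ : Measure α} [NormedAddCommGroup E] [NormedSpace ℂ E]

/-- The operator `E → L²(μ)`, `e ↦ (x ↦ F x e)` defined by a square integrable function `F` with
values in the dual of `E`, as a function of `F`. For a Hilbert space `E` these are the
Hilbert–Schmidt operators. -/
noncomputable def hilbertSchmidt : Lp (E →L[ℂ] ℂ) 2 μ →L[ℂ] E →L[ℂ] Lp ℂ 2 μ :=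
  (ContinuousLinearMap.compLpL₂ 2 μ (ContinuousLinearMap.id ℂ (E →L[ℂ] ℂ)).flip).flip

theorem coeFn_hilbertSchmidt (F : Lp (E →L[ℂ] ℂ) 2 μ) (e : E) :
    hilbertSchmidt F e =ᵐ[μ] fun x ↦ F x e := by
  filter_upwards [((ContinuousLinearMap.id ℂ (E →L[ℂ] ℂ)).flip e).coeFn_compLp F] with x hx
  simpa [hilbertSchmidt] using hx

/-- For simple `F` the operator has finite rank, and the compact operators form a closed
subspace. -/
theorem isCompactOperator_hilbertSchmidt (F : Lp (E →L[ℂ] ℂ) 2 μ) :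
    IsCompactOperator (hilbertSchmidt F) := by
  refine Lp.induction (p := 2) (by simp)
    (motive := fun F : Lp (E →L[ℂ] ℂ) 2 μ ↦ IsCompactOperator (hilbertSchmidt F)) ?_ ?_ ?_ F
  · intro c s hs hμs
    have h : (hilbertSchmidt (Lp.simpleFunc.indicatorConst 2 hs hμs.ne c : Lp (E →L[ℂ] ℂ) 2 μ)) =
        (ContinuousLinearMap.toSpanSingleton ℂ (indicatorConstLp 2 hs hμs.ne (1 : ℂ))).comp c := by
      ext1 e
      apply Lp.ext
      rw [Lp.simpleFunc.coe_indicatorConst]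
      filter_upwards [coeFn_hilbertSchmidt (indicatorConstLp 2 hs hμs.ne c) e,
        indicatorConstLp_coeFn (p := 2) (hs := hs) (hμs := hμs.ne) (c := c),
        indicatorConstLp_coeFn (p := 2) (hs := hs) (hμs := hμs.ne) (c := (1 : ℂ)),
        Lp.coeFn_smul (c e) (indicatorConstLp 2 hs hμs.ne (1 : ℂ))] with x h1 h2 h3 h4
      rw [h1, h2]
      simp only [ContinuousLinearMap.comp_apply, ContinuousLinearMap.toSpanSingleton_apply]
      rw [h4, Pi.smul_apply, h3]
      by_cases hx : x ∈ s <;> simp [hx]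
    rw [h]
    exact (isCompactOperator_of_locallyCompactSpace_rng
      (ContinuousLinearMap.toSpanSingleton ℂ (indicatorConstLp 2 hs hμs.ne (1 : ℂ)))).comp_clm c
  · intro f g hf hg _ h1 h2
    rw [map_add]
    exact h1.add h2
  · exact isClosed_setOfPred_isCompactOperator.preimage
      (hilbertSchmidt (μ := μ) (E := E)).continuous

end HilbertSchmidt

/-- Dominated convergence: a pointwise continuous family of functions with a common bound in `L²`
is continuous as a map into `L²`. -/
theorem continuous_toLp_of_dominated {α X E : Type*} [MeasurableSpace α] {μ : Measure α}
    [TopologicalSpace X] [FirstCountableTopology X] [NormedAddCommGroup E]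
    {f : X → α → E} (hf : ∀ x, MemLp (f x) 2 μ) {g : α → ℝ} (hg : MemLp g 2 μ)
    (hb : ∀ x a, ‖f x a‖ ≤ g a) (hc : ∀ a, Continuous fun x ↦ f x a) :
    Continuous fun x ↦ (hf x).toLp (f x) := by
  rw [continuous_iff_continuousAt]
  intro y
  refine (Lp.tendsto_Lp_iff_tendsto_eLpNorm'' _ _ _ (hf y)).mpr ?_
  have h : Tendsto (fun x ↦ ∫⁻ a, ‖(f x - f y) a‖ₑ ^ (2 : ℝ) ∂μ) (𝓝 y) (𝓝 (∫⁻ _, 0 ∂μ)) := by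
    refine tendsto_lintegral_filter_of_dominated_convergence'
      (fun a ↦ ‖(2 : ℝ) * g a‖ₑ ^ (2 : ℝ)) ?_ ?_ ?_ ?_
    · exact Eventually.of_forall fun x ↦ (((hf x).1.sub (hf y).1).enorm.pow_const _)
    · refine Eventually.of_forall fun x ↦ Eventually.of_forall fun a ↦ ?_
      gcongr
      refine enorm_le_iff_norm_le.mpr ?_
      have h0 : 0 ≤ g a := (norm_nonneg _).trans (hb y a)
      rw [Real.norm_of_nonneg (by positivity), Pi.sub_apply]
      linarith [norm_sub_le (f x a) (f y a), hb x a, hb y a]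
    · have := (hg.const_mul 2)
      have h2 := (lintegral_rpow_enorm_lt_top_of_eLpNorm_lt_top (by simp) (by simp) this.2)
      simpa using h2.ne
    · refine Eventually.of_forall fun a ↦ ?_
      have h1 : Tendsto (fun x ↦ ‖(f x - f y) a‖ₑ ^ (2 : ℝ)) (𝓝 y)
          (𝓝 (‖(f y - f y) a‖ₑ ^ (2 : ℝ))) := by
        have : Continuous fun x ↦ ‖(f x - f y) a‖ₑ ^ (2 : ℝ) :=
          ENNReal.continuous_rpow_const.comp (((hc a).sub continuous_const).enorm)
        exact this.tendsto y
      simpa using h1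
  simp only [lintegral_zero] at h
  have h2 := ENNReal.continuous_rpow_const (y := 1 / 2) |>.tendsto _ |>.comp h
  simp_rw [eLpNorm_eq_lintegral_rpow_enorm_toReal (two_ne_zero) (ENNReal.ofNat_ne_top (n := 2))]
  simpa [Function.comp_def] using h2

/-! ### Decreasing enumerations -/

/-- A nonempty set of positive numbers which is finite away from `0` can be listed in decreasing
order. -/
theorem exists_strictAntiOn_enumeration {S : Set ℝ} (hne : S.Nonempty)
    (hfin : ∀ s ∈ S, {t ∈ S | s ≤ t}.Finite) :
    ∃ (N : Set ℕ) (lam : ℕ → ℝ), ((∃ m : ℕ, N = Set.Iic m) ∨ N = Set.univ) ∧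
      StrictAntiOn lam N ∧ lam '' N = S := by
  -- the position of `s` is the number of larger elements
  let c : ℝ → ℕ := fun s ↦ {t ∈ S | s < t}.ncard
  have hfin' : ∀ s ∈ S, {t ∈ S | s < t}.Finite := fun s hs ↦
    (hfin s hs).subset fun t ht ↦ ⟨ht.1, ht.2.le⟩
  have hanti : StrictAntiOn c S := by
    intro s hs t ht hst
    refine Set.ncard_lt_ncard ?_ (hfin' s hs)
    refine ⟨fun r hr ↦ ⟨hr.1, hst.trans hr.2⟩, fun h ↦ ?_⟩
    exact lt_irrefl t (h ⟨ht, hst⟩ : t ∈ S ∧ t < t).2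
  have hpred : ∀ k, k + 1 ∈ c '' S → k ∈ c '' S := by
    rintro k ⟨s, hs, hk⟩
    have hne' : {t ∈ S | s < t}.Nonempty := by
      rw [← Set.ncard_pos (hfin' s hs)]
      change 0 < c s
      lia
    obtain ⟨t, ⟨htS, hst⟩, hmin⟩ := (hfin' s hs).exists_minimalFor id _ hne'
    refine ⟨t, htS, ?_⟩
    have h : {r ∈ S | s < r} = insert t {r ∈ S | t < r} := by
      ext r
      constructor
      · rintro ⟨hr, hsr⟩
        rcases lt_trichotomy r t with h | h | h
        · exact absurd (hmin ⟨hr, hsr⟩ h.le) (not_le.mpr h)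
        · exact Or.inl h
        · exact Or.inr ⟨hr, h⟩
      · rintro (rfl | ⟨hr, htr⟩)
        · exact ⟨htS, hst⟩
        · exact ⟨hr, hst.trans htr⟩
    have h2 : c s = c t + 1 := by
      change Set.ncard _ = _
      rw [h, Set.ncard_insert_of_notMem (fun h ↦ lt_irrefl t h.2) (hfin' t htS)]
    lia
  have hlower : IsLowerSet (c '' S) := by
    intro a b hba ha
    obtain ⟨d, rfl⟩ := Nat.exists_eq_add_of_le hba
    induction d with
    | zero => exact ha
    | succ d ih => exact ih (by lia) (hpred _ ha)
  have hinv : Set.LeftInvOn (Function.invFunOn c S) c S := hanti.injOn.leftInvOn_invFunOn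
  refine ⟨c '' S, Function.invFunOn c S, ?_, ?_, ?_⟩
  · by_cases hb : BddAbove (c '' S)
    · left
      refine ⟨sSup (c '' S), ?_⟩
      ext k
      exact ⟨fun hk ↦ le_csSup hb hk, fun hk ↦ hlower hk (Nat.sSup_mem (hne.image c) hb)⟩
    · right
      rw [Set.eq_univ_iff_forall]
      intro k
      rw [not_bddAbove_iff] at hb
      obtain ⟨j, hj, hkj⟩ := hb k
      exact hlower hkj.le hj
  · rintro _ ⟨s, hs, rfl⟩ _ ⟨t, ht, rfl⟩ hst
    rw [hinv hs, hinv ht]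
    exact (hanti.lt_iff_gt hs ht).mp hst
  · rw [← Set.image_comp]
    ext s
    constructor
    · rintro ⟨t, ht, rfl⟩
      simpa [hinv ht] using ht
    · intro hs
      exact ⟨s, hs, hinv hs⟩

/-! ### The Fourier transform on `L²` and the Sobolev space -/

/-- Distributional products of `L²` functions with functions of temperate growth are pointwise
products. -/
theorem toTemperedDistribution_eq_smulLeftCLM_iff {f g : L2} {h : ℝ → ℂ}
    (hh : h.HasTemperateGrowth) :
    (g : 𝓢'(ℝ, ℂ)) = smulLeftCLM ℂ h (f : 𝓢'(ℝ, ℂ)) ↔ g =ᵐ[volume] fun x ↦ h x * f x := by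
  constructor
  · intro hgf
    have hf : LocallyIntegrable f (volume : Measure ℝ) :=
      (Lp.memLp f).locallyIntegrable (by norm_num)
    have hg : LocallyIntegrable g (volume : Measure ℝ) :=
      (Lp.memLp g).locallyIntegrable (by norm_num)
    have hhf : LocallyIntegrable (fun x ↦ h x * f x) (volume : Measure ℝ) := by
      rw [← locallyIntegrableOn_univ] at hf ⊢
      exact hf.continuousOn_smul isOpen_univ.isLocallyClosed hh.1.continuous.continuousOn
    refine ae_eq_of_integral_contDiff_smul_eq hg hhf fun φ φ_smooth φ_supp ↦ ?_
    have h1 : HasCompactSupport (Complex.ofRealCLM ∘ φ) := φ_supp.comp_left rfl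
    have h2 : ContDiff ℝ ((⊤ : ℕ∞) : WithTop ℕ∞) (Complex.ofRealCLM ∘ φ) :=
      Complex.ofRealCLM.contDiff.comp φ_smooth
    have h3 := congrArg (fun T : 𝓢'(ℝ, ℂ) ↦ T (h1.toSchwartzMap h2)) hgf
    simpa [hh, mul_assoc, mul_left_comm] using h3
  · intro hgf
    ext φ
    simp only [Lp.toTemperedDistribution_apply, smulLeftCLM_apply_apply]
    refine integral_congr_ae ?_
    filter_upwards [hgf] with x hx
    simp only [hx, smul_eq_mul, SchwartzMap.smulLeftCLM_apply_apply hh]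
    ring

/-- For an integrable function in `L²`, the inverse Fourier transform is given by the integral
formula. -/
theorem fourierInv_coeFn_of_integrable {g : L2} (hg : Integrable g (volume : Measure ℝ)) :
    (𝓕⁻ g : L2) =ᵐ[volume] 𝓕⁻ (g : ℝ → ℂ) := by
  have hcont : Continuous (𝓕⁻ (g : ℝ → ℂ)) :=
    VectorFourier.fourierIntegral_continuous Real.continuous_fourierChar
      (L := -innerₗ ℝ) continuous_inner.neg hg
  refine ae_eq_of_integral_contDiff_smul_eq
    ((Lp.memLp (𝓕⁻ g : L2)).locallyIntegrable (by norm_num)) hcont.locallyIntegrable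
    fun φ φ_smooth φ_supp ↦ ?_
  have h1 : HasCompactSupport (Complex.ofRealCLM ∘ φ) := φ_supp.comp_left rfl
  have h2 : ContDiff ℝ ((⊤ : ℕ∞) : WithTop ℕ∞) (Complex.ofRealCLM ∘ φ) :=
      Complex.ofRealCLM.contDiff.comp φ_smooth
  set Φ : 𝓢(ℝ, ℂ) := h1.toSchwartzMap h2 with hΦ
  have h3 : ∫ x, (𝓕⁻ Φ) x • g x = ∫ x, Φ x • 𝓕⁻ (g : ℝ → ℂ) x := by
    have := VectorFourier.integral_fourierIntegral_smul_eq_flip (L := -innerₗ ℝ)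
      Real.continuous_fourierChar continuous_inner.neg (Φ.integrable (μ := volume)) hg
    have hflip : (-innerₗ ℝ).flip = -innerₗ ℝ := by
      ext; simp
    rw [hflip] at this
    rw [SchwartzMap.fourierInv_coe]
    exact this
  have h4 : (((𝓕⁻ g : L2)) : 𝓢'(ℝ, ℂ)) Φ = (g : 𝓢'(ℝ, ℂ)) (𝓕⁻ Φ) := by
    rw [← Lp.fourierInv_toTemperedDistribution_eq]
    rfl
  rw [Lp.toTemperedDistribution_apply, Lp.toTemperedDistribution_apply, h3] at h4
  simpa [hΦ] using h4

/-- The symbol of `-∂ₓ²`. -/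
noncomputable def symbol (ξ : ℝ) : ℝ := (2 * Real.pi * ξ) ^ 2

theorem symbol_nonneg (ξ : ℝ) : 0 ≤ symbol ξ := sq_nonneg _

@[fun_prop]
theorem continuous_symbol : Continuous symbol := by
  unfold symbol; fun_prop

theorem fourier_secondDeriv (u : sobolevH2) :
    (𝓕 (secondDeriv u) : L2) =ᵐ[volume] fun ξ ↦ -(symbol ξ : ℂ) * (𝓕 (u : L2) : L2) ξ := by
  rw [← toTemperedDistribution_eq_smulLeftCLM_iff (by unfold symbol; fun_prop),
    ← Lp.fourier_toTemperedDistribution_eq, secondDeriv_spec, fourier_lineDerivOp_eq,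
    fourier_lineDerivOp_eq, ← Lp.fourier_toTemperedDistribution_eq, map_smul,
    smulLeftCLM_smulLeftCLM_apply (by fun_prop) (by fun_prop), smul_smul,
    ← smul_apply, ← smulLeftCLM_smul (by fun_prop)]
  congr 2
  ext ξ
  simp only [symbol, Pi.smul_apply, Pi.mul_apply, smul_eq_mul]
  simp
  ring_nf
  simp [Complex.I_sq]

/-- The converse of `fourier_secondDeriv`: `u ∈ H²` as soon as `(2πξ)² û ∈ L²`. -/
theorem mem_sobolevH2_of_fourier {u g : L2}
    (h : g =ᵐ[volume] fun ξ ↦ (symbol ξ : ℂ) * (𝓕 u : L2) ξ) : u ∈ sobolevH2 := by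
  change MemSobolev 2 2 (u : 𝓢'(ℝ, ℂ))
  rw [memSobolev_iff_exists_smulLeftCLM_fourier]
  refine ⟨(𝓕 u : L2) + (((2 * Real.pi) ^ 2 : ℝ) : ℂ)⁻¹ • g, ?_⟩
  rw [Lp.fourier_toTemperedDistribution_eq, eq_comm,
    toTemperedDistribution_eq_smulLeftCLM_iff (by fun_prop)]
  filter_upwards [h, Lp.coeFn_add (𝓕 u : L2) ((((2 * Real.pi) ^ 2 : ℝ) : ℂ)⁻¹ • g),
    Lp.coeFn_smul ((((2 * Real.pi) ^ 2 : ℝ) : ℂ)⁻¹) g] with ξ h1 h2 h3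
  rw [h2, Pi.add_apply, h3, Pi.smul_apply, h1]
  have : (Real.pi : ℂ) ≠ 0 := by exact_mod_cast Real.pi_ne_zero
  simp [symbol]
  field_simp

theorem L2.ext_fourier {f g : L2} (h : (𝓕 f : L2) =ᵐ[volume] (𝓕 g : L2)) : f = g :=
  (Lp.fourierTransformₗᵢ ℝ ℂ).injective (Lp.ext h)

/-- The free operator `-∂ₓ² - z` on the Fourier side. -/
theorem fourier_neg_secondDeriv_sub (u : sobolevH2) (z : ℂ) :
    (𝓕 (-secondDeriv u - z • (u : L2)) : L2) =ᵐ[volume]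
      fun ξ ↦ ((symbol ξ : ℂ) - z) * (𝓕 (u : L2) : L2) ξ := by
  have h : (𝓕 (-secondDeriv u - z • (u : L2)) : L2) =
      -(𝓕 (secondDeriv u) : L2) - z • (𝓕 (u : L2) : L2) := by
    change Lp.fourierTransformₗᵢ ℝ ℂ _ = _
    simp only [map_sub, map_neg, map_smul]
    rfl
  rw [h]
  filter_upwards [fourier_secondDeriv u, Lp.coeFn_sub (-(𝓕 (secondDeriv u) : L2))
    (z • (𝓕 (u : L2) : L2)), Lp.coeFn_neg (𝓕 (secondDeriv u) : L2),
    Lp.coeFn_smul z (𝓕 (u : L2) : L2)] with ξ h1 h2 h3 h4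
  rw [h2, Pi.sub_apply, h3, Pi.neg_apply, h1, h4, Pi.smul_apply, smul_eq_mul]
  ring

/-! ### The free resolvent -/

/-- Multiplication by a bounded function on `L²`. -/
noncomputable def mulBdd (m : Lp ℂ ∞ (volume : Measure ℝ)) : L2 →L[ℂ] L2 :=
  (ContinuousLinearMap.mul ℂ ℂ).holderL volume ∞ 2 2 m

theorem coeFn_mulBdd {m : ℝ → ℂ} (hm : MemLp m ∞ volume) (f : L2) :
    mulBdd (hm.toLp m) f =ᵐ[volume] fun x ↦ m x * f x := by
  filter_upwards [(ContinuousLinearMap.mul ℂ ℂ).coeFn_holder (r := 2) (hm.toLp m) f,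
    hm.coeFn_toLp] with x h1 h2
  rw [mulBdd, ContinuousLinearMap.holderL_apply_apply, h1, h2]
  rfl

/-- The distance from `z ∉ [0, ∞)` to `t ∈ [0, ∞)` grows linearly in `t`, uniformly: it is at least
`dist(z, [0, ∞)) > 0`, and at least `t - |z|`. -/
theorem exists_le_norm_sub {z : ℂ} (hz : z ∉ (fun x : ℝ ↦ (x : ℂ)) '' Set.Ici 0) :
    ∃ c > 0, ∀ t : ℝ, 0 ≤ t → c * (1 + t) ≤ ‖(t : ℂ) - z‖ := by
  have hclosed : IsClosed ((fun x : ℝ ↦ (x : ℂ)) '' Set.Ici 0) :=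
    Complex.isometry_ofReal.isClosedEmbedding.isClosedMap _ isClosed_Ici
  have hne : ((fun x : ℝ ↦ (x : ℂ)) '' Set.Ici 0).Nonempty := ⟨0, 0, by simp, by simp⟩
  set δ := Metric.infDist z ((fun x : ℝ ↦ (x : ℂ)) '' Set.Ici 0)
  have hδ : 0 < δ := (hclosed.notMem_iff_infDist_pos hne).mp hz
  have hpos : 0 < 1 + (1 + ‖z‖) / δ := by positivity
  refine ⟨(1 + (1 + ‖z‖) / δ)⁻¹, by positivity, fun t ht ↦ ?_⟩
  have h1 : δ ≤ ‖(t : ℂ) - z‖ := by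
    rw [← dist_eq_norm, dist_comm]
    exact Metric.infDist_le_dist_of_mem ⟨t, ht, rfl⟩
  have h2 : t ≤ ‖(t : ℂ) - z‖ + ‖z‖ := by
    have := norm_add_le ((t : ℂ) - z) z
    rwa [sub_add_cancel, Complex.norm_real, Real.norm_of_nonneg ht] at this
  rw [inv_mul_le_iff₀ hpos]
  have h3 : 1 + ‖z‖ ≤ (1 + ‖z‖) / δ * ‖(t : ℂ) - z‖ := by
    rw [div_mul_eq_mul_div, le_div_iff₀ hδ]
    gcongr
  linarith

/-- The symbol of the free resolvent `(-∂ₓ² - z)⁻¹`. -/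
noncomputable def resolventSymbol (z : ℂ) (ξ : ℝ) : ℂ := ((symbol ξ : ℂ) - z)⁻¹

theorem symbol_sub_ne_zero {z : ℂ} (hz : z ∉ (fun x : ℝ ↦ (x : ℂ)) '' Set.Ici 0) (ξ : ℝ) :
    (symbol ξ : ℂ) - z ≠ 0 :=
  fun h ↦ hz ⟨symbol ξ, symbol_nonneg ξ, sub_eq_zero.mp h⟩

theorem continuous_resolventSymbol {z : ℂ} (hz : z ∉ (fun x : ℝ ↦ (x : ℂ)) '' Set.Ici 0) :
    Continuous (resolventSymbol z) :=
  Continuous.inv₀ (by fun_prop) (symbol_sub_ne_zero hz)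

theorem exists_norm_resolventSymbol_le {z : ℂ} (hz : z ∉ (fun x : ℝ ↦ (x : ℂ)) '' Set.Ici 0) :
    ∃ C > 0, ∀ ξ, ‖resolventSymbol z ξ‖ ≤ C * (1 + symbol ξ)⁻¹ := by
  obtain ⟨c, hc, h⟩ := exists_le_norm_sub hz
  refine ⟨c⁻¹, by positivity, fun ξ ↦ ?_⟩
  have := symbol_nonneg ξ
  rw [resolventSymbol, norm_inv, ← mul_inv]
  exact inv_anti₀ (by positivity) (h _ this)

theorem memLp_resolventSymbol {z : ℂ} (hz : z ∉ (fun x : ℝ ↦ (x : ℂ)) '' Set.Ici 0) :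
    MemLp (resolventSymbol z) ∞ volume := by
  obtain ⟨C, hC, h⟩ := exists_norm_resolventSymbol_le hz
  refine memLp_top_of_bound (continuous_resolventSymbol hz).aestronglyMeasurable C
    (Eventually.of_forall fun ξ ↦ (h ξ).trans ?_)
  have : (1 + symbol ξ)⁻¹ ≤ 1 := inv_le_one_of_one_le₀ (by linarith [symbol_nonneg ξ])
  nlinarith

theorem memLp_two_resolventSymbol {z : ℂ} (hz : z ∉ (fun x : ℝ ↦ (x : ℂ)) '' Set.Ici 0) :
    MemLp (resolventSymbol z) 2 volume := by
  obtain ⟨C, hC, h⟩ := exists_norm_resolventSymbol_le hz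
  rw [memLp_two_iff_integrable_sq_norm (continuous_resolventSymbol hz).aestronglyMeasurable]
  refine (integrable_inv_one_add_sq.const_mul (C ^ 2)).mono'
    ((continuous_resolventSymbol hz).norm.pow 2).aestronglyMeasurable
    (Eventually.of_forall fun ξ ↦ ?_)
  rw [norm_pow, norm_norm]
  have h1 : 1 + ξ ^ 2 ≤ 1 + symbol ξ := by
    have hπ : 1 ≤ (2 * Real.pi) ^ 2 := one_le_pow₀ (by linarith [Real.pi_gt_three])
    rw [symbol, mul_pow]
    nlinarith [mul_le_mul_of_nonneg_right hπ (sq_nonneg ξ)]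
  have h2 : (1 + symbol ξ)⁻¹ ≤ (1 + ξ ^ 2)⁻¹ := inv_anti₀ (by positivity) h1
  have h3 : (1 + symbol ξ)⁻¹ ≤ 1 := inv_le_one_of_one_le₀ (by linarith [symbol_nonneg ξ])
  have h4 : 0 ≤ (1 + symbol ξ)⁻¹ := inv_nonneg.mpr (by linarith [symbol_nonneg ξ])
  calc ‖resolventSymbol z ξ‖ ^ 2 ≤ (C * (1 + symbol ξ)⁻¹) ^ 2 := by gcongr; exact h ξ
    _ = C ^ 2 * ((1 + symbol ξ)⁻¹ * (1 + symbol ξ)⁻¹) := by ring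
    _ ≤ C ^ 2 * (1 * (1 + ξ ^ 2)⁻¹) := by gcongr
    _ = C ^ 2 * (1 + ξ ^ 2)⁻¹ := by ring

/-- The Fourier transform as a bounded operator. -/
noncomputable def fourierL : L2 →L[ℂ] L2 :=
  (Lp.fourierTransformₗᵢ ℝ ℂ).toContinuousLinearEquiv.toContinuousLinearMap

/-- The inverse Fourier transform as a bounded operator. -/
noncomputable def fourierInvL : L2 →L[ℂ] L2 :=
  (Lp.fourierTransformₗᵢ ℝ ℂ).symm.toContinuousLinearEquiv.toContinuousLinearMap

/-- The free resolvent `(-∂ₓ² - z)⁻¹` for `z ∉ [0, ∞)`. -/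
noncomputable def freeResolvent {z : ℂ} (hz : z ∉ (fun x : ℝ ↦ (x : ℂ)) '' Set.Ici 0) :
    L2 →L[ℂ] L2 :=
  fourierInvL ∘L mulBdd ((memLp_resolventSymbol hz).toLp _) ∘L fourierL

theorem fourier_freeResolvent {z : ℂ} (hz : z ∉ (fun x : ℝ ↦ (x : ℂ)) '' Set.Ici 0) (f : L2) :
    (𝓕 (freeResolvent hz f) : L2) =ᵐ[volume] fun ξ ↦ resolventSymbol z ξ * (𝓕 f : L2) ξ := by
  have : (𝓕 (freeResolvent hz f) : L2) = mulBdd ((memLp_resolventSymbol hz).toLp _) (𝓕 f) :=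
    fourier_fourierInv_eq _
  rw [this]
  exact coeFn_mulBdd _ _

theorem freeResolvent_mem {z : ℂ} (hz : z ∉ (fun x : ℝ ↦ (x : ℂ)) '' Set.Ici 0) (f : L2) :
    freeResolvent hz f ∈ sobolevH2 := by
  refine mem_sobolevH2_of_fourier (g := (𝓕 f : L2) + z • (𝓕 (freeResolvent hz f) : L2)) ?_
  filter_upwards [fourier_freeResolvent hz f, Lp.coeFn_add (𝓕 f : L2)
    (z • (𝓕 (freeResolvent hz f) : L2)), Lp.coeFn_smul z (𝓕 (freeResolvent hz f) : L2)]
    with ξ h1 h2 h3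
  rw [h2, Pi.add_apply, h3, Pi.smul_apply, h1, resolventSymbol, smul_eq_mul]
  have := symbol_sub_ne_zero hz ξ
  field_simp
  ring

theorem neg_secondDeriv_sub_freeResolvent {z : ℂ}
    (hz : z ∉ (fun x : ℝ ↦ (x : ℂ)) '' Set.Ici 0) (f : L2) (h : freeResolvent hz f ∈ sobolevH2) :
    -secondDeriv ⟨freeResolvent hz f, h⟩ - z • freeResolvent hz f = f := by
  refine L2.ext_fourier ?_
  filter_upwards [fourier_neg_secondDeriv_sub ⟨freeResolvent hz f, h⟩ z,
    fourier_freeResolvent hz f] with ξ h1 h2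
  rw [h1, h2, resolventSymbol]
  exact mul_inv_cancel_left₀ (symbol_sub_ne_zero hz ξ) _

theorem freeResolvent_neg_secondDeriv_sub {z : ℂ}
    (hz : z ∉ (fun x : ℝ ↦ (x : ℂ)) '' Set.Ici 0) (u : sobolevH2) :
    freeResolvent hz (-secondDeriv u - z • (u : L2)) = u := by
  refine L2.ext_fourier ?_
  filter_upwards [fourier_neg_secondDeriv_sub u z,
    fourier_freeResolvent hz (-secondDeriv u - z • (u : L2))] with ξ h1 h2
  rw [h2, h1, resolventSymbol]
  exact inv_mul_cancel_left₀ (symbol_sub_ne_zero hz ξ) _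

theorem ofReal_notMem_Ici_of_neg {t : ℝ} (ht : t < 0) :
    (t : ℂ) ∉ (fun x : ℝ ↦ (x : ℂ)) '' Set.Ici 0 := by
  rintro ⟨s, hs, hst⟩
  have : s = t := Complex.ofReal_injective hst
  exact absurd (this ▸ hs : (0 : ℝ) ≤ t) (not_le.mpr ht)

/-- `-∂ₓ² - t ≥ |t|` for `t < 0`. -/
theorem abs_mul_norm_le_neg_secondDeriv_sub {t : ℝ} (ht : t < 0) (u : sobolevH2) :
    |t| * ‖(u : L2)‖ ≤ ‖-secondDeriv u - (t : ℂ) • (u : L2)‖ := by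
  rw [← Lp.norm_fourier_eq (u : L2), ← Lp.norm_fourier_eq (-secondDeriv u - (t : ℂ) • (u : L2)),
    ← le_div_iff₀' (abs_pos.mpr ht.ne), div_eq_inv_mul]
  refine Lp.norm_le_mul_norm_of_ae_le_mul ?_
  filter_upwards [fourier_neg_secondDeriv_sub u t] with ξ h
  rw [h, norm_mul, ← div_eq_inv_mul, le_div_iff₀' (abs_pos.mpr ht.ne)]
  gcongr
  rw [← Complex.ofReal_sub, Complex.norm_real, Real.norm_eq_abs, abs_of_neg ht,
    abs_of_nonneg (by linarith [symbol_nonneg ξ])]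
  linarith [symbol_nonneg ξ]

/-! ### Wave packets -/

/-- The function whose Fourier transform is `c` times the indicator of `s`. -/
noncomputable def wavePacket {s : Set ℝ} (hs : MeasurableSet s) (hμ : volume s ≠ ∞) (c : ℂ) : L2 :=
  𝓕⁻ (indicatorConstLp 2 hs hμ c : L2)

section WavePacket

variable {s : Set ℝ} (hs : MeasurableSet s) (hμ : volume s ≠ ∞) (c : ℂ)

theorem fourier_wavePacket : (𝓕 (wavePacket hs hμ c) : L2) = indicatorConstLp 2 hs hμ c :=
  fourier_fourierInv_eq _

theorem wavePacket_mem {C : ℝ} (hC : ∀ ξ ∈ s, symbol ξ ≤ C) :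
    wavePacket hs hμ c ∈ sobolevH2 := by
  have h : MemLp (fun ξ ↦ s.indicator (fun ξ ↦ (symbol ξ : ℂ)) ξ) ∞ volume := by
    refine memLp_top_of_bound ((Measurable.indicator (by fun_prop) hs).aestronglyMeasurable)
      (max C 0)
      (Eventually.of_forall fun ξ ↦ ?_)
    by_cases hξ : ξ ∈ s
    · rw [Set.indicator_of_mem hξ, Complex.norm_real, Real.norm_of_nonneg (symbol_nonneg ξ)]
      exact (hC ξ hξ).trans (le_max_left _ _)
    · simp [hξ]
  refine mem_sobolevH2_of_fourier (g := mulBdd (h.toLp _) (indicatorConstLp 2 hs hμ c)) ?_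
  rw [fourier_wavePacket]
  filter_upwards [coeFn_mulBdd h (indicatorConstLp 2 hs hμ c),
    indicatorConstLp_coeFn (p := 2) (hs := hs) (hμs := hμ) (c := c)] with ξ h1 h2
  rw [h1, h2]
  by_cases hξ : ξ ∈ s <;> simp [hξ]

theorem norm_neg_secondDeriv_sub_wavePacket_le {E δ : ℝ} (hE : ∀ ξ ∈ s, |symbol ξ - E| ≤ δ)
    (h : wavePacket hs hμ c ∈ sobolevH2) :
    ‖-secondDeriv ⟨wavePacket hs hμ c, h⟩ - (E : ℂ) • wavePacket hs hμ c‖ ≤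
      δ * ‖wavePacket hs hμ c‖ := by
  rw [← Lp.norm_fourier_eq (wavePacket hs hμ c), ← Lp.norm_fourier_eq (-_ - _)]
  refine Lp.norm_le_mul_norm_of_ae_le_mul ?_
  have h0 := fourier_neg_secondDeriv_sub ⟨wavePacket hs hμ c, h⟩ E
  rw [fourier_wavePacket] at h0 ⊢
  filter_upwards [h0, indicatorConstLp_coeFn (p := 2) (hs := hs) (hμs := hμ) (c := c)]
    with ξ h1 h2
  rw [h1, norm_mul, h2]
  by_cases hξ : ξ ∈ s
  · gcongr
    rw [← Complex.ofReal_sub, Complex.norm_real]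
    exact hE ξ hξ
  · simp [hξ]

theorem inner_wavePacket {t : Set ℝ} (ht : MeasurableSet t) (hμt : volume t ≠ ∞) (d : ℂ) :
    inner ℂ (wavePacket hs hμ c) (wavePacket ht hμt d) =
      volume.real (s ∩ t) • inner ℂ c d := by
  rw [← Lp.inner_fourier_eq, fourier_wavePacket, fourier_wavePacket,
    L2.inner_indicatorConstLp_indicatorConstLp hs ht hμ hμt]

theorem wavePacket_coeFn : (wavePacket hs hμ c : L2) =ᵐ[volume]
    fun x ↦ ∫ ξ in s, Real.fourierChar (ξ * x) • c := by
  have hi : Integrable (indicatorConstLp 2 hs hμ c : L2) (volume : Measure ℝ) :=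
    ((integrable_indicator_iff hs).mpr (integrableOn_const hμ)).congr
      (indicatorConstLp_coeFn (p := 2) (hs := hs) (hμs := hμ) (c := c)).symm
  filter_upwards [fourierInv_coeFn_of_integrable hi] with x hx
  rw [wavePacket, hx, Real.fourierInv_eq, ← integral_indicator hs]
  refine integral_congr_ae ?_
  filter_upwards [indicatorConstLp_coeFn (p := 2) (hs := hs) (hμs := hμ) (c := c)] with ξ hξ
  rw [hξ]
  by_cases h : ξ ∈ s <;> simp [h, mul_comm]

end WavePacket

variable {V : ℝ → ℝ}

/-! ### The Schrödinger operator is symmetric -/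

/-- The multiplication operator `u ↦ V u` as a bounded operator. -/
noncomputable def potentialL (hV : IsAdmissiblePotential V) : L2 →L[ℂ] L2 :=
  mulBdd (hV.memLp_top.toLp _)

theorem coeFn_potentialL (hV : IsAdmissiblePotential V) (u : L2) :
    potentialL hV u =ᵐ[volume] fun x ↦ (V x : ℂ) * u x :=
  coeFn_mulBdd hV.memLp_top u

theorem mulPotential_eq_potentialL (hV : IsAdmissiblePotential V) (u : L2) :
    mulPotential hV u = potentialL hV u := by
  refine Lp.ext ?_
  filter_upwards [coeFn_potentialL hV u, (hV.memLp_mul u).coeFn_toLp] with x h1 h2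
  rw [h1]
  exact h2

theorem operatorA_apply (hV : IsAdmissiblePotential V) (u : sobolevH2) :
    operatorA hV u = -secondDeriv u + potentialL hV u := by
  rw [← mulPotential_eq_potentialL]
  rfl

theorem inner_potentialL (hV : IsAdmissiblePotential V) (u v : L2) :
    inner ℂ (potentialL hV u) v = inner ℂ u (potentialL hV v) := by
  rw [L2.inner_def, L2.inner_def]
  refine integral_congr_ae ?_
  filter_upwards [coeFn_potentialL hV u, coeFn_potentialL hV v] with x h1 h2
  rw [h1, h2]
  simp only [RCLike.inner_apply, map_mul, Complex.conj_ofReal]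
  ring

theorem inner_secondDeriv (u v : sobolevH2) :
    inner ℂ (secondDeriv u) (v : L2) = inner ℂ (u : L2) (secondDeriv v) := by
  rw [← Lp.inner_fourier_eq (secondDeriv u), ← Lp.inner_fourier_eq (u : L2), L2.inner_def,
    L2.inner_def]
  refine integral_congr_ae ?_
  filter_upwards [fourier_secondDeriv u, fourier_secondDeriv v] with x h1 h2
  rw [h1, h2]
  simp only [RCLike.inner_apply, map_mul, map_neg, Complex.conj_ofReal]
  ring

theorem inner_operatorA (hV : IsAdmissiblePotential V) (u v : sobolevH2) :
    inner ℂ (operatorA hV u) (v : L2) = inner ℂ (u : L2) (operatorA hV v) := by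
  rw [operatorA_apply, operatorA_apply, inner_add_left, inner_add_right, inner_neg_left,
    inner_neg_right, inner_secondDeriv, inner_potentialL]

theorem IsEigenvalue.im_eq_zero {hV : IsAdmissiblePotential V} {z : ℂ}
    (hz : IsEigenvalue (operatorA hV) z) : z.im = 0 := by
  obtain ⟨u, hu, h⟩ := hz
  have h1 := inner_operatorA hV u u
  rw [h, inner_smul_left, inner_smul_right] at h1
  have h2 : inner ℂ (u : L2) (u : L2) ≠ 0 := inner_self_ne_zero.mpr (by simpa using hu)
  exact Complex.conj_eq_iff_im.mp (mul_right_cancel₀ h2 h1)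

/-! ### Relative compactness of the potential -/

/-- `V ∈ L²`, since `V` is integrable and bounded. -/
theorem memLp_two_potential (hV : IsAdmissiblePotential V) : MemLp V 2 volume := by
  rw [memLp_two_iff_integrable_sq hV.continuous.aestronglyMeasurable]
  obtain ⟨C, hC⟩ : ∃ C, ∀ᵐ x, ‖V x‖ ≤ C := by
    have h := hV.memLp_top
    refine ⟨(eLpNorm (fun x ↦ (V x : ℂ)) ∞ volume).toReal, ?_⟩
    have h2 := ae_le_eLpNormEssSup (f := fun x ↦ (V x : ℂ)) (μ := (volume : Measure ℝ))
    filter_upwards [h2] with x hx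
    rw [← eLpNorm_exponent_top] at hx
    have := ENNReal.toReal_mono h.2.ne hx
    simpa using this
  simpa [sq] using hV.integrable.bdd_mul hV.continuous.aestronglyMeasurable hC

section Compact

variable {z : ℂ}

/-- The function `ξ ↦ conj (m(ξ) e^{2πixξ})`, with `m` the symbol of the free resolvent. -/
noncomputable def kernelFun (z : ℂ) (x ξ : ℝ) : ℂ :=
  starRingEnd ℂ (resolventSymbol z ξ * Real.fourierChar (ξ * x))

theorem norm_kernelFun (x ξ : ℝ) : ‖kernelFun z x ξ‖ = ‖resolventSymbol z ξ‖ := by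
  rw [kernelFun, RCLike.norm_conj, norm_mul, Circle.norm_coe, mul_one]

theorem memLp_kernelFun (hz : z ∉ (fun x : ℝ ↦ (x : ℂ)) '' Set.Ici 0) (x : ℝ) :
    MemLp (kernelFun z x) 2 volume := by
  refine (memLp_two_resolventSymbol hz).congr_norm ?_
    (Eventually.of_forall fun ξ ↦ (norm_kernelFun x ξ).symm)
  have h : Continuous fun ξ : ℝ ↦ ((Real.fourierChar (ξ * x) : Circle) : ℂ) :=
    continuous_subtype_val.comp (Real.continuous_fourierChar.comp (by fun_prop))
  exact (Complex.continuous_conj.comp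
    ((continuous_resolventSymbol hz).mul h)).aestronglyMeasurable

theorem continuous_toLp_kernelFun (hz : z ∉ (fun x : ℝ ↦ (x : ℂ)) '' Set.Ici 0) :
    Continuous fun x ↦ (memLp_kernelFun hz x).toLp (kernelFun z x) := by
  refine continuous_toLp_of_dominated _ (memLp_two_resolventSymbol hz).norm
    (fun x ξ ↦ (norm_kernelFun x ξ).le) fun ξ ↦ ?_
  have h : Continuous fun x : ℝ ↦ ((Real.fourierChar (ξ * x) : Circle) : ℂ) :=
    continuous_subtype_val.comp (Real.continuous_fourierChar.comp (by fun_prop))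
  exact Complex.continuous_conj.comp (continuous_const.mul h)

theorem norm_toLp_kernelFun (hz : z ∉ (fun x : ℝ ↦ (x : ℂ)) '' Set.Ici 0) (x : ℝ) :
    ‖(memLp_kernelFun hz x).toLp (kernelFun z x)‖ =
    ‖(memLp_two_resolventSymbol hz).toLp (resolventSymbol z)‖ := by
  rw [Lp.norm_toLp, Lp.norm_toLp]
  congr 1
  exact eLpNorm_congr_norm_ae (Eventually.of_forall fun ξ ↦ norm_kernelFun x ξ)

/-- `V (-∂ₓ² - z)⁻¹ 𝓕⁻¹` is the integral operator with kernel `V(x) m(ξ) e^{2πixξ}`, which is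
square integrable since both `V` and `m` are. -/
theorem isCompactOperator_potentialL_freeResolvent
    (hz : z ∉ (fun x : ℝ ↦ (x : ℂ)) '' Set.Ici 0) (hV : IsAdmissiblePotential V) :
    IsCompactOperator (potentialL hV ∘L freeResolvent hz) := by
  let F : ℝ → (L2 →L[ℂ] ℂ) := fun x ↦
    (V x : ℂ) • innerSL ℂ ((memLp_kernelFun hz x).toLp (kernelFun z x))
  have hFc : Continuous F := (Complex.continuous_ofReal.comp hV.continuous).smul
    ((innerSL ℂ).continuous.comp (continuous_toLp_kernelFun hz))
  have hF : MemLp F 2 volume := by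
    refine ((memLp_two_potential hV).const_mul
      ‖(memLp_two_resolventSymbol hz).toLp (resolventSymbol z)‖).of_le
      hFc.aestronglyMeasurable (Eventually.of_forall fun x ↦ ?_)
    rw [norm_smul, innerSL_apply_norm, norm_toLp_kernelFun hz, norm_mul, norm_norm, mul_comm,
      Complex.norm_real]
  have heq : potentialL hV ∘L freeResolvent hz = hilbertSchmidt (hF.toLp F) ∘L fourierL := by
    ext1 f
    refine Lp.ext ?_
    set g : L2 := fourierL f
    set m := mulBdd ((memLp_resolventSymbol hz).toLp _) g with hm
    have hmg : m =ᵐ[volume] fun ξ ↦ resolventSymbol z ξ * g ξ :=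
      coeFn_mulBdd (memLp_resolventSymbol hz) g
    have hint : Integrable m (volume : Measure ℝ) :=
      ((memLp_two_resolventSymbol hz).integrable_mul (Lp.memLp g)).congr hmg.symm
    have h0 : (potentialL hV ∘L freeResolvent hz) f = potentialL hV (𝓕⁻ m) := rfl
    rw [h0]
    filter_upwards [coeFn_potentialL hV (𝓕⁻ m), fourierInv_coeFn_of_integrable hint,
      coeFn_hilbertSchmidt (hF.toLp F) g, hF.coeFn_toLp] with x h1 h2 h3 h4
    rw [ContinuousLinearMap.comp_apply, h1, h2, h3, h4]
    change _ = (V x : ℂ) * inner ℂ ((memLp_kernelFun hz x).toLp (kernelFun z x)) g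
    rw [L2.inner_def, Real.fourierInv_eq]
    congr 1
    refine integral_congr_ae ?_
    filter_upwards [hmg, (memLp_kernelFun hz x).coeFn_toLp] with ξ h5 h6
    have hin : inner ℝ ξ x = ξ * x := by simp [mul_comm]
    rw [h5, h6, hin, RCLike.inner_apply, kernelFun, Complex.conj_conj, Circle.smul_def,
      smul_eq_mul]
    ring
  rw [heq]
  exact (isCompactOperator_hilbertSchmidt (hF.toLp F)).comp_clm fourierL

end Compact

/-! ### The Fredholm alternative -/

/-- Outside `[0, ∞)`, write `𝒜 - z = (1 + V R₀(z)) (-∂ₓ² - z)` with `R₀(z)` the free resolvent. -/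
theorem mem_resolventSet_or_isEigenvalue (hV : IsAdmissiblePotential V) {z : ℂ}
    (hz : z ∉ (fun x : ℝ ↦ (x : ℂ)) '' Set.Ici 0) :
    z ∈ resolventSet (operatorA hV) ∨ IsEigenvalue (operatorA hV) z := by
  set K := potentialL hV ∘L freeResolvent hz with hK
  have hAz : ∀ u : sobolevH2, operatorA hV u - z • (u : L2) =
      (-secondDeriv u - z • (u : L2)) + K (-secondDeriv u - z • (u : L2)) := by
    intro u
    rw [hK, ContinuousLinearMap.comp_apply, freeResolvent_neg_secondDeriv_sub, operatorA_apply]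
    abel
  have hcomp : IsCompactOperator (-K : L2 →L[ℂ] L2) :=
    (isCompactOperator_potentialL_freeResolvent hz hV).neg
  rcases hcomp.hasEigenvalue_or_mem_resolventSet one_ne_zero with h | h
  · right
    obtain ⟨f, hf⟩ := h.exists_hasEigenvector
    have hf1 : -K f = f := by simpa using hf.apply_eq_smul
    refine ⟨⟨freeResolvent hz f, freeResolvent_mem hz f⟩, fun h0 ↦ hf.2 ?_, ?_⟩
    · have h1 : freeResolvent hz f = 0 := congrArg Subtype.val h0
      rw [← hf1, hK, ContinuousLinearMap.comp_apply, h1, map_zero, neg_zero]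
    · have h1 := hAz ⟨freeResolvent hz f, freeResolvent_mem hz f⟩
      rw [neg_secondDeriv_sub_freeResolvent] at h1
      have h2 : f + K f = 0 := by rw [← neg_eq_iff_add_eq_zero, ← hf1, neg_neg, hf1]
      exact sub_eq_zero.mp (h1.trans h2)
  · left
    obtain ⟨W, hW⟩ := spectrum.mem_resolventSet_iff.mp h
    have hW' : (W : L2 →L[ℂ] L2) = 1 + K := by
      rw [hW]; simp
    have h1 : ∀ f, (↑W⁻¹ : L2 →L[ℂ] L2) f + K ((↑W⁻¹ : L2 →L[ℂ] L2) f) = f := by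
      intro f
      have := congrArg (fun T : L2 →L[ℂ] L2 ↦ T f) W.mul_inv
      rwa [hW'] at this
    have h2 : ∀ f, (↑W⁻¹ : L2 →L[ℂ] L2) (f + K f) = f := by
      intro f
      have := congrArg (fun T : L2 →L[ℂ] L2 ↦ T f) W.inv_mul
      rwa [hW'] at this
    refine ⟨freeResolvent hz ∘L (↑W⁻¹ : L2 →L[ℂ] L2), fun f ↦ ⟨freeResolvent_mem hz _, ?_⟩,
      fun u ↦ ?_⟩
    · have h3 := hAz ⟨_, freeResolvent_mem hz ((↑W⁻¹ : L2 →L[ℂ] L2) f)⟩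
      rw [neg_secondDeriv_sub_freeResolvent, h1] at h3
      exact h3
    · rw [hAz u, ContinuousLinearMap.comp_apply, h2]
      exact freeResolvent_neg_secondDeriv_sub hz u

theorem IsEigenvalue.mem_spectrum {E : Type*} [NormedAddCommGroup E] [NormedSpace ℂ E]
    {T : E →ₗ.[ℂ] E} {z : ℂ} (h : IsEigenvalue T z) : z ∈ spectrum T := by
  rintro ⟨R, -, hR⟩
  obtain ⟨u, hu, hTu⟩ := h
  refine hu (Subtype.ext ?_)
  rw [← hR u, hTu, sub_self, map_zero]
  rfl

/-! ### Weyl sequences -/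

/-- Along an orthonormal sequence which is bounded in the graph norm of `-∂ₓ²`, with `-∂ₓ² + 1`
acting as `a n + B` up to an error tending to `0`, the potential tends to `0`. -/
theorem tendsto_potentialL_orthonormal (hV : IsAdmissiblePotential V) {u : ℕ → sobolevH2}
    (hu : Orthonormal ℂ fun n ↦ (u n : L2)) {a : ℕ → ℂ} {C : ℝ} (ha : ∀ n, ‖a n‖ ≤ C)
    (B : L2 →L[ℂ] L2) {r : ℕ → L2} (hr : Tendsto r atTop (𝓝 0))
    (h : ∀ n, -secondDeriv (u n) + (u n : L2) = a n • (u n : L2) + B (u n) + r n) :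
    Tendsto (fun n ↦ potentialL hV (u n)) atTop (𝓝 0) := by
  have hz : ((-1 : ℝ) : ℂ) ∉ (fun x : ℝ ↦ (x : ℂ)) '' Set.Ici 0 :=
    ofReal_notMem_Ici_of_neg (by norm_num)
  set K := potentialL hV ∘L freeResolvent hz with hK
  have hKc : IsCompactOperator K := isCompactOperator_potentialL_freeResolvent hz hV
  have h1 : ∀ n, potentialL hV (u n) = a n • K (u n) + (K ∘L B) (u n) + K (r n) := by
    intro n
    have h2 := freeResolvent_neg_secondDeriv_sub hz (u n)
    have h3 : -secondDeriv (u n) - ((-1 : ℝ) : ℂ) • (u n : L2) =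
        a n • (u n : L2) + B (u n) + r n := by
      rw [← h n, Complex.ofReal_neg, Complex.ofReal_one, neg_smul, one_smul, sub_neg_eq_add]
    rw [h3] at h2
    have h4 : K (a n • (u n : L2) + B (u n) + r n) = potentialL hV (u n) :=
      congrArg (potentialL hV) h2
    rw [← h4, map_add, map_add, map_smul]
    rfl
  simp_rw [h1]
  have h3 : Tendsto (fun n ↦ a n • K (u n)) atTop (𝓝 0) :=
    (isBoundedUnder_of ⟨C, ha⟩ : IsBoundedUnder (· ≤ ·) atTop (norm ∘ a)).smul_tendsto_zero
      (tendsto_compact_orthonormal hKc hu)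
  have h4 : Tendsto (fun n ↦ (K ∘L B) (u n)) atTop (𝓝 0) :=
    tendsto_compact_orthonormal (K := K ∘L B) (hKc.comp_clm B) hu
  have h5 : Tendsto (fun n ↦ K (r n)) atTop (𝓝 0) := by
    have := (K.continuous.tendsto 0).comp hr
    rwa [map_zero] at this
  simpa using (h3.add h4).add h5

/-- An orthonormal Weyl sequence for `-∂ₓ²` at the point `(2πk)²`. -/
theorem exists_orthonormal_weylSequence (k : ℝ) (hk : 0 ≤ k) :
    ∃ u : ℕ → sobolevH2, Orthonormal ℂ (fun n ↦ (u n : L2)) ∧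
      Tendsto (fun n ↦ -secondDeriv (u n) - (symbol k : ℂ) • (u n : L2)) atTop (𝓝 0) := by
  -- normalised wave packets over disjoint frequency intervals shrinking to `k`
  let b : ℕ → ℝ := fun n ↦ k + 1 / ((n : ℝ) + 1)
  have hb : StrictAnti b := by
    intro m n hmn
    simp only [b]
    gcongr
  let s : ℕ → Set ℝ := fun n ↦ Set.Ioc (b (n + 1)) (b n)
  have hs : ∀ n, MeasurableSet (s n) := fun n ↦ measurableSet_Ioc
  have hμ : ∀ n, volume (s n) ≠ ∞ := fun n ↦ by simp [s]
  have hvol : ∀ n, 0 < volume.real (s n) := fun n ↦ by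
    simp only [s, Real.volume_real_Ioc]
    exact lt_max_of_lt_left (sub_pos.mpr (hb (Nat.lt_succ_self n)))
  have hdisj : Pairwise (Function.onFun Disjoint s) := hb.antitone.pairwise_disjoint_on_Ioc_succ
  let δ : ℕ → ℝ := fun n ↦ (2 * Real.pi) ^ 2 * (2 * k + 1) * (1 / ((n : ℝ) + 1))
  have hδ : ∀ n, ∀ ξ ∈ s n, |symbol ξ - symbol k| ≤ δ n := by
    rintro n ξ ⟨h1, h2⟩
    have h3 : k < b (n + 1) := by 
      have : 0 < 1 / (((n + 1 : ℕ) : ℝ) + 1) := by positivity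
      simp only [b]
      linarith
    have h4 : 1 / ((n : ℝ) + 1) ≤ 1 := by
      rw [div_le_one (by positivity)]; linarith [n.cast_nonneg (α := ℝ)]
    simp only [b] at h2
    have h5 : symbol ξ - symbol k = (2 * Real.pi) ^ 2 * (ξ + k) * (ξ - k) := by
      unfold symbol; ring
    rw [h5, abs_of_nonneg (by
      have : 0 ≤ ξ - k := by linarith
      have : 0 ≤ ξ + k := by linarith
      positivity)]
    simp only [δ]
    have h6 : ξ + k ≤ 2 * k + 1 := by linarith
    have h7 : ξ - k ≤ 1 / ((n : ℝ) + 1) := by linarith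
    have h8 : 0 ≤ ξ - k := by linarith
    gcongr
  let c : ℕ → ℂ := fun n ↦ ((√(volume.real (s n)))⁻¹ : ℝ)
  have hmem : ∀ n, wavePacket (hs n) (hμ n) (c n) ∈ sobolevH2 := fun n ↦
    wavePacket_mem _ _ _ (C := symbol k + δ n) fun ξ hξ ↦ by
      linarith [(abs_le.mp (hδ n ξ hξ)).2]
  have hon : Orthonormal ℂ fun n ↦ wavePacket (hs n) (hμ n) (c n) := by
    rw [orthonormal_iff_ite]
    intro i j
    rw [inner_wavePacket]
    split_ifs with hij
    · subst hij
      rw [Set.inter_self]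
      simp only [c, RCLike.inner_apply, Complex.conj_ofReal, ← Complex.ofReal_mul, ← mul_inv]
      rw [Real.mul_self_sqrt (hvol i).le, Complex.real_smul, ← Complex.ofReal_mul,
        mul_inv_cancel₀ (hvol i).ne', Complex.ofReal_one]
    · rw [Set.disjoint_iff_inter_eq_empty.mp (hdisj hij)]
      simp
  refine ⟨fun n ↦ ⟨_, hmem n⟩, hon, ?_⟩
  have hδ0 : Tendsto δ atTop (𝓝 0) := by
    have := (tendsto_one_div_add_atTop_nhds_zero_nat (𝕜 := ℝ)).const_mul
      ((2 * Real.pi) ^ 2 * (2 * k + 1))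
    rwa [mul_zero] at this
  refine squeeze_zero_norm (fun n ↦ ?_) hδ0
  have := norm_neg_secondDeriv_sub_wavePacket_le (hs n) (hμ n) (c n) (hδ n) (hmem n)
  rwa [hon.1 n, mul_one] at this

theorem ofReal_mem_spectrum (hV : IsAdmissiblePotential V) {E : ℝ} (hE : 0 ≤ E) :
    (E : ℂ) ∈ spectrum (operatorA hV) := by
  obtain ⟨k, hk, rfl⟩ : ∃ k, 0 ≤ k ∧ symbol k = E := by
    refine ⟨√E / (2 * Real.pi), by positivity, ?_⟩
    rw [symbol, mul_div_cancel₀ _ (by positivity), Real.sq_sqrt hE]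
  obtain ⟨u, hu, hr⟩ := exists_orthonormal_weylSequence k hk
  have hVu := tendsto_potentialL_orthonormal hV hu (a := fun _ ↦ (symbol k : ℂ) + 1)
    (fun _ ↦ le_rfl) 0 hr (fun n ↦ by
      rw [add_smul, one_smul, zero_apply]
      abel)
  rintro ⟨R, -, hR⟩
  have h1 : Tendsto (fun n ↦ operatorA hV (u n) - (symbol k : ℂ) • (u n : L2)) atTop (𝓝 0) := by
    have h2 := hr.add hVu
    rw [add_zero] at h2
    refine h2.congr fun n ↦ ?_
    rw [operatorA_apply]
    abel
  have h3 : Tendsto (fun n ↦ ‖(u n : L2)‖) atTop (𝓝 0) := by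
    have h4 := ((R.continuous.tendsto 0).comp h1).norm
    simp only [map_zero, norm_zero] at h4
    refine h4.congr fun n ↦ ?_
    exact congrArg norm (hR (u n))
  simp only [hu.1] at h3
  exact one_ne_zero (tendsto_nhds_unique tendsto_const_nhds h3)

/-! ### Negative eigenvalues accumulate only at zero -/

theorem neg_secondDeriv_sub_of_eigen (hV : IsAdmissiblePotential V) {t : ℂ} {u : sobolevH2}
    (h : operatorA hV u = t • (u : L2)) :
    -secondDeriv u - t • (u : L2) = -potentialL hV u := by
  rw [← h, operatorA_apply]
  abel

theorem abs_le_of_isEigenvalue (hV : IsAdmissiblePotential V) {t : ℝ} (ht : t < 0)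
    (h : IsEigenvalue (operatorA hV) t) : |t| ≤ ‖potentialL hV‖ := by
  obtain ⟨u, hu, h⟩ := h
  have h1 := abs_mul_norm_le_neg_secondDeriv_sub ht u
  rw [neg_secondDeriv_sub_of_eigen hV h, norm_neg] at h1
  have h2 : 0 < ‖(u : L2)‖ := norm_pos_iff.mpr (by simpa using hu)
  exact le_of_mul_le_mul_right (h1.trans ((potentialL hV).le_opNorm _)) h2

/-- Normalised eigenfunctions `u n` for infinitely many eigenvalues below `-ε` would be
orthonormal with `V (u n) → 0`, while `ε ‖u n‖ ≤ ‖V (u n)‖`. -/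
theorem finite_isEigenvalue_le (hV : IsAdmissiblePotential V) {ε : ℝ} (hε : 0 < ε) :
    {t : ℝ | t ≤ -ε ∧ IsEigenvalue (operatorA hV) t}.Finite := by
  by_contra hinf
  let t := Set.Infinite.natEmbedding _ hinf
  have hex : ∀ n, ∃ u : sobolevH2, ‖(u : L2)‖ = 1 ∧
      operatorA hV u = ((t n : ℝ) : ℂ) • (u : L2) := by
    intro n
    obtain ⟨u, hu, h⟩ := (t n).2.2
    have hu' : (u : L2) ≠ 0 := by simpa using hu
    refine ⟨((‖(u : L2)‖⁻¹ : ℝ) : ℂ) • u, ?_, ?_⟩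
    · rw [Submodule.coe_smul, norm_smul, Complex.norm_real, norm_inv, norm_norm,
        inv_mul_cancel₀ (norm_ne_zero_iff.mpr hu')]
    · have := (operatorA hV).map_smul ((‖(u : L2)‖⁻¹ : ℝ) : ℂ) u
      refine this.trans ?_
      rw [h, Submodule.coe_smul, smul_comm]
  choose u hu1 hu2 using hex
  have hneg : ∀ n, (t n : ℝ) < 0 := fun n ↦ (t n).2.1.trans_lt (neg_neg_of_pos hε)
  have hon : Orthonormal ℂ fun n ↦ (u n : L2) := by
    refine ⟨hu1, fun i j hij ↦ ?_⟩
    have h1 := inner_operatorA hV (u i) (u j)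
    rw [hu2, hu2, inner_smul_left, inner_smul_right, Complex.conj_ofReal, ← sub_eq_zero,
      ← sub_mul, mul_eq_zero, sub_eq_zero] at h1
    refine h1.resolve_left fun h2 ↦ hij (t.injective (Subtype.ext (Complex.ofReal_injective h2)))
  have hVu := tendsto_potentialL_orthonormal hV hon (a := fun n ↦ ((t n : ℝ) : ℂ) + 1)
    (C := ‖potentialL hV‖ + 1) (fun n ↦ by
      refine (norm_add_le _ _).trans ?_
      rw [Complex.norm_real, norm_one, Real.norm_eq_abs]
      linarith [abs_le_of_isEigenvalue hV (hneg n) (t n).2.2])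
    (-potentialL hV) tendsto_const_nhds (fun n ↦ by
      rw [add_smul, one_smul, add_zero, neg_apply, ← neg_secondDeriv_sub_of_eigen hV (hu2 n)]
      abel)
  have hle : ∀ n, ε ≤ ‖potentialL hV (u n)‖ := fun n ↦ by
    have h1 := abs_mul_norm_le_neg_secondDeriv_sub (hneg n) (u n)
    rw [neg_secondDeriv_sub_of_eigen hV (hu2 n), norm_neg, hu1, mul_one,
      abs_of_neg (hneg n)] at h1
    linarith [(t n).2.1]
  have := ge_of_tendsto' hVu.norm hle
  rw [norm_zero] at this
  exact absurd this (not_le.mpr hε)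

/-! ### Existence of a negative eigenvalue -/

theorem norm_fourierChar_sub_one_le (t : ℝ) :
    ‖((Real.fourierChar t : Circle) : ℂ) - 1‖ ≤ 2 * Real.pi * |t| := by
  have h := Real.norm_exp_I_mul_ofReal_sub_one_le (x := 2 * Real.pi * t)
  rw [Real.norm_eq_abs, abs_mul, abs_of_pos Real.two_pi_pos] at h
  rw [Real.fourierChar_apply, mul_comm]
  exact h

/-- The wave packets with Fourier transform `ε⁻¹ 1_(0, ε]` are bounded by `1` and tend to `1`
pointwise as `ε → 0`, while their kinetic energy `⟪-u'', u⟫` is at most `(2π)² ε`; so the total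
energy tends to `∫ V < 0`. -/
theorem exists_inner_operatorA_neg (hV : IsAdmissiblePotential V) :
    ∃ u : sobolevH2, (inner ℂ (operatorA hV u) (u : L2)).re < 0 := by
  let ε : ℕ → ℝ := fun n ↦ 1 / ((n : ℝ) + 1)
  have hε : ∀ n, 0 < ε n := fun n ↦ by positivity
  have hε0 : Tendsto ε atTop (𝓝 0) := tendsto_one_div_add_atTop_nhds_zero_nat
  let s : ℕ → Set ℝ := fun n ↦ Set.Ioc 0 (ε n)
  have hs : ∀ n, MeasurableSet (s n) := fun n ↦ measurableSet_Ioc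
  have hμ : ∀ n, volume (s n) ≠ ∞ := fun n ↦ by simp [s]
  have hvol : ∀ n, volume.real (s n) = ε n := fun n ↦ by
    simp [s, Real.volume_real_Ioc, (hε n).le]
  let c : ℕ → ℂ := fun n ↦ ((ε n)⁻¹ : ℝ)
  let u : ℕ → L2 := fun n ↦ wavePacket (hs n) (hμ n) (c n)
  let φ : ℕ → ℝ → ℂ := fun n x ↦ ∫ ξ in s n, Real.fourierChar (ξ * x) • c n
  have hu : ∀ n, u n =ᵐ[volume] φ n := fun n ↦ wavePacket_coeFn (hs n) (hμ n) (c n)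
  have hc : ∀ n, ‖c n‖ = (ε n)⁻¹ := fun n ↦ by
    rw [Complex.norm_real, Real.norm_of_nonneg (inv_nonneg.mpr (hε n).le)]
  have hφ1 : ∀ n x, ‖φ n x‖ ≤ 1 := by
    intro n x
    refine (norm_setIntegral_le_of_norm_le_const (C := (ε n)⁻¹) (hμ n).lt_top
      fun ξ _ ↦ ?_).trans ?_
    · rw [Circle.norm_smul, hc]
    · rw [hvol, inv_mul_cancel₀ (hε n).ne']
  have hφc : ∀ n x, Continuous fun ξ : ℝ ↦ Real.fourierChar (ξ * x) • c n := fun n x ↦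
    (Real.continuous_fourierChar.comp (by fun_prop)).smul continuous_const
  have hφ2 : ∀ n x, ‖φ n x - 1‖ ≤ 2 * Real.pi * |x| * ε n := by
    intro n x
    have h1 : φ n x - 1 = ∫ ξ in s n, (Real.fourierChar (ξ * x) • c n - c n) := by
      rw [integral_sub ((hφc n x).integrableOn_Ioc) (integrable_const_iff.mpr (Or.inr (by
        simp [isFiniteMeasure_restrict]))), setIntegral_const, hvol]
      simp only [c, φ]
      rw [Complex.real_smul, ← Complex.ofReal_mul, mul_inv_cancel₀ (hε n).ne', Complex.ofReal_one]
    rw [h1]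
    refine (norm_setIntegral_le_of_norm_le_const (C := 2 * Real.pi * |x| * ε n * (ε n)⁻¹)
      (hμ n).lt_top fun ξ hξ ↦ ?_).trans (le_of_eq ?_)
    · have h2 : Real.fourierChar (ξ * x) • c n - c n =
          (((Real.fourierChar (ξ * x) : Circle) : ℂ) - 1) * c n := by
        rw [Circle.smul_def, smul_eq_mul]; ring
      rw [h2, norm_mul, hc]
      refine mul_le_mul_of_nonneg_right ((norm_fourierChar_sub_one_le _).trans ?_)
        (inv_nonneg.mpr (hε n).le)
      rw [abs_mul, abs_of_pos hξ.1, mul_comm ξ, ← mul_assoc]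
      have := Real.pi_pos
      gcongr
      exact hξ.2
    · rw [hvol, mul_assoc, inv_mul_cancel₀ (hε n).ne', mul_one]
  have hsym : ∀ n, ∀ ξ ∈ s n, |symbol ξ - 0| ≤ (2 * Real.pi * ε n) ^ 2 := by
    intro n ξ hξ
    have h1 := hξ.1
    have h2 := hξ.2
    have := Real.pi_pos
    rw [sub_zero, abs_of_nonneg (symbol_nonneg ξ), symbol]
    gcongr
  have hmem : ∀ n, u n ∈ sobolevH2 := fun n ↦
    wavePacket_mem _ _ _ (C := (2 * Real.pi * ε n) ^ 2) fun ξ hξ ↦ by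
      linarith [(abs_le.mp (hsym n ξ hξ)).2]
  have hnorm : ∀ n, ‖u n‖ ^ 2 = (ε n)⁻¹ := by
    intro n
    have h1 := inner_self_eq_norm_sq_to_K (𝕜 := ℂ) (u n)
    rw [inner_wavePacket, Set.inter_self, hvol, RCLike.inner_apply] at h1
    simp only [c] at h1
    rw [Complex.conj_ofReal, Complex.real_smul, ← mul_assoc, ← Complex.ofReal_mul,
      mul_inv_cancel₀ (hε n).ne', Complex.ofReal_one, one_mul] at h1
    exact Complex.ofReal_injective (by rw [h1]; exact (Complex.ofReal_pow _ _))
  have hkin : ∀ n, (inner ℂ (-secondDeriv ⟨u n, hmem n⟩) (u n)).re ≤ (2 * Real.pi) ^ 2 * ε n := by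
    intro n
    have h1 := norm_neg_secondDeriv_sub_wavePacket_le (hs n) (hμ n) (c n) (hsym n) (hmem n)
    rw [Complex.ofReal_zero, zero_smul, sub_zero] at h1
    calc (inner ℂ (-secondDeriv ⟨u n, hmem n⟩) (u n)).re
        ≤ ‖-secondDeriv ⟨u n, hmem n⟩‖ * ‖u n‖ :=
          (Complex.re_le_norm _).trans (norm_inner_le_norm _ _)
      _ ≤ (2 * Real.pi * ε n) ^ 2 * ‖u n‖ * ‖u n‖ := by gcongr
      _ = (2 * Real.pi * ε n) ^ 2 * ‖u n‖ ^ 2 := by ring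
      _ = (2 * Real.pi) ^ 2 * ε n := by
        rw [hnorm]
        field_simp [(hε n).ne']
  have hpot : ∀ n, inner ℂ (potentialL hV (u n)) (u n) = ((∫ x, V x * ‖φ n x‖ ^ 2 : ℝ) : ℂ) := by
    intro n
    rw [L2.inner_def, ← integral_complex_ofReal]
    refine integral_congr_ae ?_
    filter_upwards [coeFn_potentialL hV (u n), hu n] with x h1 h2
    rw [h1, h2, RCLike.inner_apply, map_mul, Complex.conj_ofReal, mul_left_comm, Complex.mul_conj,
      Complex.normSq_eq_norm_sq, Complex.ofReal_mul]
  have hlim : Tendsto (fun n ↦ ∫ x, V x * ‖φ n x‖ ^ 2) atTop (𝓝 (∫ x, V x)) := by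
    refine tendsto_integral_of_dominated_convergence (fun x ↦ ‖V x‖) (fun n ↦ ?_)
      hV.integrable.norm (fun n ↦ Eventually.of_forall fun x ↦ ?_)
      (Eventually.of_forall fun x ↦ ?_)
    · exact hV.continuous.aestronglyMeasurable.mul
        (((Lp.aestronglyMeasurable (u n)).congr (hu n)).norm.pow 2)
    · rw [norm_mul, norm_pow, norm_norm]
      exact mul_le_of_le_one_right (norm_nonneg _) (pow_le_one₀ (norm_nonneg _) (hφ1 n x))
    · have h1 : Tendsto (fun n ↦ φ n x) atTop (𝓝 1) := by
        rw [tendsto_iff_norm_sub_tendsto_zero]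
        refine squeeze_zero (fun _ ↦ norm_nonneg _) (fun n ↦ hφ2 n x) ?_
        have := hε0.const_mul (2 * Real.pi * |x|)
        rwa [mul_zero] at this
      have h2 := (h1.norm.pow 2).const_mul (V x)
      rwa [norm_one, one_pow, mul_one] at h2
  have hsum := (hε0.const_mul ((2 * Real.pi) ^ 2)).add hlim
  rw [mul_zero, zero_add] at hsum
  obtain ⟨n, hn⟩ := (hsum.eventually_lt_const hV.integral_neg).exists
  refine ⟨⟨u n, hmem n⟩, ?_⟩
  rw [operatorA_apply, inner_add_left, Complex.add_re]
  have h1 : (inner ℂ (potentialL hV (u n)) (u n)).re = ∫ x, V x * ‖φ n x‖ ^ 2 := by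
    rw [hpot, Complex.ofReal_re]
  have h2 := hkin n
  linarith

/-- The functional calculus for the polynomial `x - x²`. -/
theorem isPositive_sub_sq {H : Type*} [NormedAddCommGroup H] [InnerProductSpace ℂ H]
    [CompleteSpace H] {R : H →L[ℂ] H} (hR : IsSelfAdjoint R)
    (hspec : ∀ μ ∈ _root_.spectrum ℝ R, 0 ≤ μ - μ ^ 2) : (R - R ^ 2).IsPositive := by
  rw [← ContinuousLinearMap.nonneg_iff_isPositive]
  have h : cfc (fun x : ℝ ↦ x - x ^ 2) R = R - R ^ 2 := by
    rw [cfc_sub (fun x : ℝ ↦ x) (fun x ↦ x ^ 2) R, cfc_id' ℝ R, cfc_pow_id R 2]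
  rw [← h]
  exact cfc_nonneg hspec

/-- Without negative eigenvalues the resolvent `R = (𝒜 + 1)⁻¹` would be self-adjoint with spectrum
in `[0, 1]`, so that `R - R² ≥ 0`, and hence `⟪𝒜 u, u⟫ ≥ 0` for all `u`. -/
theorem exists_neg_isEigenvalue (hV : IsAdmissiblePotential V) :
    ∃ t : ℝ, t < 0 ∧ IsEigenvalue (operatorA hV) t := by
  by_contra! hno
  have hres : ∀ t : ℝ, t < 0 → (t : ℂ) ∈ resolventSet (operatorA hV) := fun t ht ↦
    (mem_resolventSet_or_isEigenvalue hV (ofReal_notMem_Ici_of_neg ht)).resolve_right (hno t ht)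
  obtain ⟨R, hR1, hR2⟩ := hres (-1) (by norm_num)
  have hRmem : ∀ f, R f ∈ sobolevH2 := fun f ↦ (hR1 f).1
  have hAR : ∀ f, operatorA hV ⟨R f, hRmem f⟩ = f - R f := by
    intro f
    obtain ⟨h, h'⟩ := hR1 f
    rw [Complex.ofReal_neg, Complex.ofReal_one, neg_smul, one_smul, sub_neg_eq_add] at h'
    exact eq_sub_of_add_eq h'
  have hRA : ∀ u : sobolevH2, R (operatorA hV u + (u : L2)) = u := by
    intro u
    have h := hR2 u
    rwa [Complex.ofReal_neg, Complex.ofReal_one, neg_smul, one_smul, sub_neg_eq_add] at h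
  have hsa : IsSelfAdjoint R := by
    rw [ContinuousLinearMap.isSelfAdjoint_iff_isSymmetric]
    intro f g
    have h : inner ℂ (operatorA hV ⟨R f, hRmem f⟩) (R g) =
        inner ℂ (R f) (operatorA hV ⟨R g, hRmem g⟩) :=
      inner_operatorA hV ⟨R f, hRmem f⟩ ⟨R g, hRmem g⟩
    have h1 := (congrArg (inner ℂ · (R g)) (hAR f)).symm.trans
      (h.trans (congrArg (inner ℂ (R f) ·) (hAR g)))
    rw [inner_sub_left, inner_sub_right] at h1
    exact (sub_left_injective h1).symm
  have hspec : ∀ μ ∈ _root_.spectrum ℝ R, 0 ≤ μ - μ ^ 2 := by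
    intro μ hμ
    by_contra! hneg
    have hμ0 : μ ≠ 0 := by rintro rfl; simp at hneg
    -- `μ` is outside `[0, 1]`, so `1 / μ - 1` is negative, hence in the resolvent set
    have hw : μ⁻¹ - 1 < 0 := by
      rcases lt_or_gt_of_ne hμ0 with h | h
      · linarith [inv_lt_zero.mpr h]
      · have : 1 < μ := by nlinarith
        linarith [inv_lt_one_of_one_lt₀ this]
    obtain ⟨S, hS1, hS2⟩ := hres _ hw
    -- the two resolvent identities relating `R` and `S = (𝒜 - (1 / μ - 1))⁻¹`
    have hRS : ∀ g, R g + ((μ⁻¹ : ℝ) : ℂ) • R (S g) = S g := by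
      intro g
      obtain ⟨h, h'⟩ := hS1 g
      have h2 := (congrArg (fun f ↦ R (f + S g)) (sub_eq_iff_eq_add.mp h')).symm.trans
        (hRA ⟨S g, h⟩)
      beta_reduce at h2
      rw [Complex.ofReal_sub, Complex.ofReal_one, sub_smul, one_smul, add_assoc,
        sub_add_cancel, map_add, map_smul] at h2
      exact h2
    have hSR : ∀ g, S g - ((μ⁻¹ : ℝ) : ℂ) • S (R g) = R g := by
      intro g
      have h := (congrArg (fun f ↦ S (f - ((μ⁻¹ - 1 : ℝ) : ℂ) • R g)) (hAR g)).symm.trans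
        (hS2 ⟨R g, hRmem g⟩)
      beta_reduce at h
      rw [Complex.ofReal_sub, Complex.ofReal_one, sub_smul, one_smul,
        sub_sub_sub_cancel_right, map_sub, map_smul] at h
      exact h
    -- the inverse of `μ - R` is `μ⁻¹ (1 + μ⁻¹ S)`
    have hμc : (μ : ℂ) ≠ 0 := by exact_mod_cast hμ0
    rw [Complex.ofReal_inv] at hRS hSR
    refine hμ ?_
    let T : L2 →L[ℂ] L2 := (μ : ℂ)⁻¹ • (1 + (μ : ℂ)⁻¹ • S)
    have hT : ∀ g, T g = (μ : ℂ)⁻¹ • (g + (μ : ℂ)⁻¹ • S g) := fun g ↦ rfl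
    have hM : ∀ g, (algebraMap ℝ (L2 →L[ℂ] L2) μ - R) g = (μ : ℂ) • g - R g := by
      intro g
      rw [Algebra.algebraMap_eq_smul_one]
      rfl
    refine ⟨⟨algebraMap ℝ (L2 →L[ℂ] L2) μ - R, T, ?_, ?_⟩, rfl⟩
    · ext1 g
      change (algebraMap ℝ (L2 →L[ℂ] L2) μ - R) (T g) = g
      rw [hM, hT, map_smul, map_add, map_smul, hRS, smul_inv_smul₀ hμc, add_sub_cancel_right]
    · ext1 g
      change T ((algebraMap ℝ (L2 →L[ℂ] L2) μ - R) g) = g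
      rw [hM, hT, map_sub, map_smul, smul_sub, inv_smul_smul₀ hμc, hSR, sub_add_cancel,
        inv_smul_smul₀ hμc]
  obtain ⟨u, hu⟩ := exists_inner_operatorA_neg hV
  have h := (isPositive_sub_sq hsa hspec).re_inner_nonneg_left (operatorA hV u + (u : L2))
  have h1 : (R - R ^ 2) (operatorA hV u + (u : L2)) = u - R u := by
    rw [sub_apply, pow_two, mul_apply_eq_comp, hRA]
  have hsymm := (ContinuousLinearMap.isSelfAdjoint_iff_isSymmetric.mp hsa) u
    (operatorA hV u + (u : L2))
  have h2 : inner ℂ (R u) (operatorA hV u + (u : L2)) = inner ℂ (u : L2) (u : L2) := by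
    refine hsymm.trans ?_
    exact congrArg (inner ℂ (u : L2)) (hRA u)
  -- with `f = (𝒜 + 1) u` and `R f = u`: `⟪(R - R²) f, f⟫ = ⟪u, f⟫ - ⟪u, u⟫ = ⟪u, 𝒜 u⟫`
  rw [h1, inner_sub_left, h2, inner_add_right, add_sub_cancel_right, ← inner_operatorA] at h
  exact absurd hu (not_lt.mpr h)

end Schroedinger

theorem mainTheorem6 (V : ℝ → ℝ) (hV : Schroedinger.IsAdmissiblePotential V) :
    ∃ (N : Set ℕ) (lam : ℕ → ℝ),
      ((∃ m : ℕ, N = Set.Iic m) ∨ N = Set.univ) ∧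
      StrictAntiOn lam N ∧
      (∀ n ∈ N, 0 < lam n) ∧
      (∀ n ∈ N, Schroedinger.IsEigenvalue (Schroedinger.operatorA hV)
        ((-(lam n) ^ 2 : ℝ) : ℂ)) ∧
      Schroedinger.spectrum (Schroedinger.operatorA hV) =
        (fun n : ℕ ↦ ((-(lam n) ^ 2 : ℝ) : ℂ)) '' N ∪
          (fun x : ℝ ↦ (x : ℂ)) '' Set.Ici 0 ∧
      (∀ z : ℂ, AccPt z (𝓟 ((fun n : ℕ ↦ ((-(lam n) ^ 2 : ℝ) : ℂ)) '' N)) → z = 0) := by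
  set A := Schroedinger.operatorA hV
  let S : Set ℝ := {s | 0 < s ∧ Schroedinger.IsEigenvalue A ((-s ^ 2 : ℝ) : ℂ)}
  have hmemS : ∀ t : ℝ, t < 0 → Schroedinger.IsEigenvalue A t → √(-t) ∈ S := by
    intro t ht h
    refine ⟨Real.sqrt_pos.mpr (by linarith), ?_⟩
    rwa [Real.sq_sqrt (by linarith), neg_neg]
  have hne : S.Nonempty := by
    obtain ⟨t, ht, h⟩ := Schroedinger.exists_neg_isEigenvalue hV
    exact ⟨_, hmemS t ht h⟩
  have hfin : ∀ s ∈ S, {t ∈ S | s ≤ t}.Finite := by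
    intro s hs
    refine Set.Finite.of_finite_image (f := fun t ↦ -t ^ 2)
      ((Schroedinger.finite_isEigenvalue_le hV (pow_pos hs.1 2)).subset ?_) ?_
    · rintro _ ⟨t, ⟨ht, hst⟩, rfl⟩
      exact ⟨neg_le_neg (pow_le_pow_left₀ hs.1.le hst 2), ht.2⟩
    · rintro t ⟨ht, -⟩ r ⟨hr, -⟩ h
      exact (pow_left_inj₀ ht.1.le hr.1.le two_ne_zero).mp (neg_injective h)
  obtain ⟨N, lam, hN, hanti, himg⟩ := Schroedinger.exists_strictAntiOn_enumeration hne hfin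
  have hlam : ∀ n ∈ N, lam n ∈ S := fun n hn ↦ himg ▸ Set.mem_image_of_mem lam hn
  refine ⟨N, lam, hN, hanti, fun n hn ↦ (hlam n hn).1, fun n hn ↦ (hlam n hn).2, ?_, ?_⟩
  · ext z
    constructor
    · intro hz
      by_cases h0 : z ∈ (fun x : ℝ ↦ (x : ℂ)) '' Set.Ici 0
      · exact Or.inr h0
      · left
        have hev := (Schroedinger.mem_resolventSet_or_isEigenvalue hV h0).resolve_left hz
        obtain ⟨t, rfl⟩ : ∃ t : ℝ, (t : ℂ) = z :=
          ⟨z.re, Complex.ext (Complex.ofReal_re _) (by simp [hev.im_eq_zero])⟩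
        have ht : t < 0 := not_le.mp fun h ↦ h0 ⟨t, h, rfl⟩
        obtain ⟨n, hn, hnt⟩ : √(-t) ∈ lam '' N := himg.symm ▸ hmemS t ht hev
        refine ⟨n, hn, ?_⟩
        simp only [hnt]
        rw [Real.sq_sqrt (by linarith), neg_neg]
    · rintro (⟨n, hn, rfl⟩ | ⟨x, hx, rfl⟩)
      · exact (hlam n hn).2.mem_spectrum
      · exact Schroedinger.ofReal_mem_spectrum hV hx
  · intro z hz
    by_contra hz0
    have hpos : 0 < ‖z‖ / 2 := half_pos (norm_pos_iff.mpr hz0)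
    -- away from `0` there are only finitely many eigenvalues
    have hnhds : {w : ℂ | ‖z‖ / 2 < ‖w‖} ∈ 𝓝 z :=
      (isOpen_lt continuous_const continuous_norm).mem_nhds (half_lt_self (norm_pos_iff.mpr hz0))
    refine Set.Infinite.not_finite (s := {w : ℂ | ‖z‖ / 2 < ‖w‖} ∩
      (fun n : ℕ ↦ ((-(lam n) ^ 2 : ℝ) : ℂ)) '' N) (Set.Infinite.of_accPt (hz.nhds_inter hnhds)) ?_
    refine ((Schroedinger.finite_isEigenvalue_le hV hpos).image (fun t : ℝ ↦ (t : ℂ))).subset ?_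
    rintro _ ⟨h, n, hn, rfl⟩
    refine ⟨-(lam n) ^ 2, ⟨?_, (hlam n hn).2⟩, rfl⟩
    rw [Set.mem_ofPred_eq, Complex.norm_real, norm_neg, Real.norm_of_nonneg (sq_nonneg _)] at h
    linarith
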